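/- A drawing of a finite simple graph maps its vertices to distinct points of the plane and each edge to a Jordan arc between the points representing its end-vertices. It is planar if no edge passes through a vertex other than its end-vertices and any two distinct edges meet only at common end-vertices, and outerplanar if moreover every vertex lies on the boundary of the outer (unbounded) face. A graph is outerplanar if it admits an outerplanar drawing. Theorem. For every integer $n \ge 1$, every $n$-vertex outerplanar graph $G$ and every integer $k \ge 4$, there exists a set $\mathcal I \subseteq V(G)$ such that the induced subgraph $G[\mathcal I]$ has maximum degree at most $k$ and $$|\mathcal I| \ge \frac{2k+1}{2k+5}\, n \quad \text{if } k \text{ is even}, \qquad |\mathcal I| \ge \frac{2k+2/3}{2k+14/3}\, n \quad \text{if } k \text{ is odd}.$$ -/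

import Mathlib

/-- The Euclidean plane. -/
abbrev Plane : Type := EuclideanSpace ℝ (Fin 2)

/-- `A` is a Jordan arc with end-points `p` and `q`: the image of an injective continuous path
from `p` to `q`. -/
def IsJordanArc (A : Set Plane) (p q : Plane) : Prop :=
  ∃ γ : Path p q, Function.Injective γ ∧ Set.range γ = A

namespace SimpleGraph

/-- A drawing of a graph in the plane: distinct vertices are mapped to distinct points, and each
edge is mapped to a Jordan arc between the points representing its end-vertices. -/
structure Drawing {V : Type*} (G : SimpleGraph V) where
  /-- the point representing a vertex -/
  point : V → Plane
  /-- the arc representing an edge -/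
  arc : G.edgeSet → Set Plane
  point_injective : Function.Injective point
  isJordanArc_arc : ∀ (u v : V) (h : G.Adj u v),
    IsJordanArc (arc ⟨s(u, v), h⟩) (point u) (point v)

namespace Drawing

variable {V : Type*} {G : SimpleGraph V}

/-- A drawing is planar if an edge passes through no vertex other than its end-vertices, and two
distinct edges meet only at (points representing) common end-vertices. -/
def IsPlanar (D : G.Drawing) : Prop :=
  (∀ (v : V) (e : G.edgeSet), D.point v ∈ D.arc e → v ∈ e.1) ∧
  (∀ e f : G.edgeSet, e ≠ f → D.arc e ∩ D.arc f ⊆ D.point '' {v | v ∈ e.1 ∧ v ∈ f.1})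

/-- The set of all points of the plane covered by the drawing. -/
def support (D : G.Drawing) : Set Plane :=
  Set.range D.point ∪ ⋃ e : G.edgeSet, D.arc e

/-- The faces of a drawing are the connected components of the complement of the drawing. -/
def IsFace (D : G.Drawing) (F : Set Plane) : Prop :=
  ∃ x ∈ D.supportᶜ, F = connectedComponentIn D.supportᶜ x

/-- The outer face (unique for a finite graph) is the unbounded face. -/
def IsOuterFace (D : G.Drawing) (F : Set Plane) : Prop :=
  D.IsFace F ∧ ¬ Bornology.IsBounded F

/-- A drawing is outerplanar if it is planar and every vertex is incident to the outer face, that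
is, lies on the boundary of the outer face. -/
def IsOuterplanar (D : G.Drawing) : Prop :=
  D.IsPlanar ∧ ∃ F : Set Plane, D.IsOuterFace F ∧ ∀ v : V, D.point v ∈ frontier F

end Drawing

/-- An outerplanar graph is a graph that admits an outerplanar drawing. -/
def IsOuterplanar {V : Type*} (G : SimpleGraph V) : Prop :=
  ∃ D : G.Drawing, D.IsOuterplanar

end SimpleGraph

/-!
Why an outerplanar graph has a large induced subgraph of maximum degree at most `k`.

*Deletion.* Let `P` be a largest set of vertices that is met by at least `(k + 2) |P|` edges, as it
would arise by deleting vertices of degree at least `k + 2` for as long as possible, and let `T` be a maximal independent set of vertices of degree `k + 1` in what remains. Deleting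
`P ∪ T` leaves maximum degree at most `k`, because `T` dominates the vertices of degree `k + 1`.
With `t = |P|` and `u = |T|`, at least `(k + 2) t + (k + 1) u` edges meet `P ∪ T`, and exactly
`(k + 1) u` edges join `T` to the remaining vertices. In an outerplanar graph on `n` vertices, at
most `n + 2 s` edges meet a given set of `s` vertices (`card_le_of_forall_uncrossed`), and a
bipartite outerplanar graph with parts `S` and `R` has at most `|R| + 2 |S|` edges
(`Noncrossing.card_le`). So `k t + (k - 1) u ≤ n` and `t + k u ≤ n` (`exists_deletion`), whence
`(k² - k + 1) (t + u) ≤ k n`; for `k ≥ 4` this is as strong as required, with equality at `k = 4`.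

*Edge bounds.* Both are proved by contracting edges, and all that is used of outerplanarity is an
invariant that survives contraction and that graphs containing `K_{2,3}` do not have: integers
`m a b` with `m a b + m b a = 1` such that `m u a + m w b = m w a + m u b` for all disjoint edges
`uw` and `ab` (`Uncrossed`). For `K_{2,3}` these equations are contradictory modulo 2
(`Uncrossed.false_of_three`).

*Topology.* The invariant comes from winding numbers
(`SimpleGraph.IsOuterplanar.exists_uncrossed`). Join a point `z` of the outer face to every vertex
`a` by a path `γ a` that avoids the other vertices and the edges not incident to `a`. Then `m a b`
counts how often the difference of two points of the plane turns around the origin while the first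
one moves from `z` to `a` along `γ a`, and then the second one from `b` to `z` along the reverse of
`γ b`. Two disjoint paths have a nowhere vanishing difference on the unit square, which has a
continuous logarithm there; this relates the numbers `m` of the ends of two disjoint edges. Neither
the Jordan curve theorem nor any regularity of the arcs is needed.
-/

/-! ### Parity obstructions to outerplanarity -/

/-- Let `m a b` be integers with `m a b + m b a = 1`, thought of as telling on which side of `a`
the vertex `b` lies, seen from the outer face. The pairs `u, w` and `a, b` are *uncrossed* if the
passage from `u` to `w` changes the position relative to `a` by as much as that relative to `b`.
Two disjoint arcs, from `u` to `w` and from `a` to `b`, that avoid the outer face make them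
uncrossed. -/
def Uncrossed {V : Type*} (m : V → V → ℤ) (u w a b : V) : Prop :=
  m u a + m w b = m w a + m u b

section

variable {V : Type*} {m : V → V → ℤ}

theorem Uncrossed.swap (hm : ∀ a b, a ≠ b → m a b + m b a = 1) {u w a b : V}
    (h : Uncrossed m u w a b) (h1 : u ≠ a) (h2 : u ≠ b) (h3 : w ≠ a) (h4 : w ≠ b) :
    Uncrossed m a b u w := by
  have := hm _ _ h1
  have := hm _ _ h2
  have := hm _ _ h3
  have := hm _ _ h4
  unfold Uncrossed at *
  omega

theorem Uncrossed.flip {u w a b : V} (h : Uncrossed m u w a b) : Uncrossed m u w b a := by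
  unfold Uncrossed at *
  omega

/-- The parity obstruction behind the non-outerplanarity of `K_{2,3}`, the parts of which are
`p, q` and `a, b, c`: the sum of the six equations is contradictory modulo 2. -/
theorem Uncrossed.false_of_three (hm : ∀ a b, a ≠ b → m a b + m b a = 1) {p q a b c : V}
    (hab : a ≠ b) (hac : a ≠ c) (hbc : b ≠ c)
    (h1 : Uncrossed m p a q b) (h2 : Uncrossed m p b q a) (h3 : Uncrossed m p a q c)
    (h4 : Uncrossed m p c q a) (h5 : Uncrossed m p b q c) (h6 : Uncrossed m p c q b) : False := by
  have := hm a b hab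
  have := hm a c hac
  have := hm b c hbc
  unfold Uncrossed at *
  omega

/-! ### Edges of bipartite outerplanar graphs -/

/-- A set of pairs, the edges of a bipartite graph, is noncrossing with respect to `m` if any two
of them without a common end are uncrossed. -/
def Noncrossing (m : V → V → ℤ) (E : Finset (V × V)) : Prop :=
  ∀ s u t w, (s, u) ∈ E → (t, w) ∈ E → s ≠ t → u ≠ w → Uncrossed m s u t w

/-- The graph in which two vertices are adjacent if they are joined by at least two paths of length
two, in the bipartite graph with edge set `E`, with middle vertices in the second part. -/
def twoCommonGraph (E : Finset (V × V)) : SimpleGraph V where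
  Adj x y := x ≠ y ∧ ∃ v w, v ≠ w ∧ (x, v) ∈ E ∧ (x, w) ∈ E ∧ (y, v) ∈ E ∧ (y, w) ∈ E
  symm := ⟨fun _ _ ⟨h, v, w, hvw, h1, h2, h3, h4⟩ ↦ ⟨h.symm, v, w, hvw, h3, h4, h1, h2⟩⟩
  loopless := ⟨fun _ h ↦ h.1 rfl⟩

variable {E : Finset (V × V)}

theorem Noncrossing.false_of_three_left (hm : ∀ a b, a ≠ b → m a b + m b a = 1)
    (h : Noncrossing m E) {x y a b c : V}
    (hxy : x ≠ y) (hab : a ≠ b) (hac : a ≠ c) (hbc : b ≠ c)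
    (hxa : (x, a) ∈ E) (hxb : (x, b) ∈ E) (hxc : (x, c) ∈ E)
    (hya : (y, a) ∈ E) (hyb : (y, b) ∈ E) (hyc : (y, c) ∈ E) : False :=
  Uncrossed.false_of_three hm hab hac hbc
    (h _ _ _ _ hxa hyb hxy hab) (h _ _ _ _ hxb hya hxy hab.symm)
    (h _ _ _ _ hxa hyc hxy hac) (h _ _ _ _ hxc hya hxy hac.symm)
    (h _ _ _ _ hxb hyc hxy hbc) (h _ _ _ _ hxc hyb hxy hbc.symm)

theorem Noncrossing.false_of_three_right (hm : ∀ a b, a ≠ b → m a b + m b a = 1)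
    (h : Noncrossing m E) {x y a b c : V}
    (hxy : x ≠ y) (hab : a ≠ b) (hac : a ≠ c) (hbc : b ≠ c)
    (hxa : (a, x) ∈ E) (hxb : (b, x) ∈ E) (hxc : (c, x) ∈ E)
    (hya : (a, y) ∈ E) (hyb : (b, y) ∈ E) (hyc : (c, y) ∈ E) : False := by
  have swap {a b} (ha : (a, x) ∈ E) (hb : (b, y) ∈ E) (hab : a ≠ b) : Uncrossed m x a y b := by
    have := h _ _ _ _ ha hb hab hxy
    unfold Uncrossed at *
    omega
  exact Uncrossed.false_of_three hm hab hac hbc (swap hxa hyb hab) (swap hxb hya hab.symm)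
    (swap hxa hyc hac) (swap hxc hya hac.symm) (swap hxb hyc hbc) (swap hxc hyb hbc.symm)

/-- If `x` and `y` have the common neighbours `v` and `w`, then the ends `a ≠ x` and `b` of any other
edge of `twoCommonGraph E` have a common neighbour outside `{v, w}`: otherwise `v` and `w` would
have three common neighbours among `x, y, a, b`. -/
theorem Noncrossing.exists_common (hm : ∀ a b, a ≠ b → m a b + m b a = 1)
    (h : Noncrossing m E) {x y v w a b : V} (hvw : v ≠ w) (hxy : x ≠ y)
    (hxv : (x, v) ∈ E) (hxw : (x, w) ∈ E) (hyv : (y, v) ∈ E) (hyw : (y, w) ∈ E)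
    (hab : (twoCommonGraph E).Adj a b) (hx : a ≠ x) (hy : b = x → a ≠ y) :
    ∃ u, u ≠ v ∧ u ≠ w ∧ (a, u) ∈ E ∧ (b, u) ∈ E := by
  obtain ⟨hne, p, q, hpq, hap, haq, hbp, hbq⟩ := hab
  by_contra! H
  have hp : p = v ∨ p = w := by
    by_contra! hc
    exact H p hc.1 hc.2 hap hbp
  have hq : q = v ∨ q = w := by
    by_contra! hc
    exact H q hc.1 hc.2 haq hbq
  have key : (a, v) ∈ E ∧ (a, w) ∈ E ∧ (b, v) ∈ E ∧ (b, w) ∈ E := by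
    rcases hp with rfl | rfl <;> rcases hq with rfl | rfl <;> simp_all
  obtain ⟨h1, h2, h3, h4⟩ := key
  by_cases hay : a = y
  · subst hay
    exact h.false_of_three_right hm hvw hxy (fun e ↦ hy e.symm rfl) hne hxv hyv h3 hxw hyw h4
  · exact h.false_of_three_right hm hvw hxy hx.symm (Ne.symm hay) hxv hyv h1 hxw hyw h2

theorem Noncrossing.isAcyclic_twoCommonGraph (hm : ∀ a b, a ≠ b → m a b + m b a = 1)
    (h : Noncrossing m E) : (twoCommonGraph E).IsAcyclic := by
  rw [SimpleGraph.isAcyclic_iff_forall_adj_isBridge]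
  intro x y hadj
  rw [SimpleGraph.isBridge_iff]
  rintro hr
  obtain ⟨p⟩ := hr.symm
  obtain ⟨hxy, v, w, hvw, hxv, hxw, hyv, hyw⟩ := hadj
  -- A walk from `y` to `x` that avoids the edge `xy` lifts to a third connection between `x` and
  -- `y`, besides `v` and `w`; the pairs `x, v` and `x, w` stay uncrossed with it.
  suffices H : ∀ a b, ((twoCommonGraph E).deleteEdges {s(x, y)}).Walk a b → b = x → a ≠ x →
      Uncrossed m x v y a → Uncrossed m x w y a → False from
    H y x p rfl hxy.symm (by unfold Uncrossed; ring) (by unfold Uncrossed; ring)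
  intro a b q
  induction q with
  | nil => exact fun h1 h2 ↦ absurd h1 h2
  | @cons a c b hac q ih =>
    intro hb ha hv hw
    rw [SimpleGraph.deleteEdges_adj] at hac
    obtain ⟨u, huv, huw, hau, hcu⟩ := h.exists_common hm hvw hxy hxv hxw hyv hyw hac.1 ha
      (by rintro rfl rfl; exact hac.2 Sym2.eq_swap)
    have e1 := h _ _ _ _ hxv hau (Ne.symm ha) (Ne.symm huv)
    have e2 := h _ _ _ _ hxw hau (Ne.symm ha) (Ne.symm huw)
    by_cases hc : c = x
    · subst hc
      refine Uncrossed.false_of_three (p := c) (q := y) (a := v) (b := w) (c := u) hm hvw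
        (Ne.symm huv) (Ne.symm huw) (h _ _ _ _ hxv hyw hxy hvw) (h _ _ _ _ hxw hyv hxy hvw.symm)
        ?_ (h _ _ _ _ hcu hyv hxy huv) ?_ (h _ _ _ _ hcu hyw hxy huw)
      all_goals unfold Uncrossed at *; omega
    · have e3 := h _ _ _ _ hxv hcu (Ne.symm hc) (Ne.symm huv)
      have e4 := h _ _ _ _ hxw hcu (Ne.symm hc) (Ne.symm huw)
      apply ih hb hc
      all_goals unfold Uncrossed at *; omega

theorem SimpleGraph.IsAcyclic.exists_subsingleton_neighborSet [Finite V] [Nonempty V]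
    {G : SimpleGraph V} (h : G.IsAcyclic) : ∃ x, ∀ y z, G.Adj x y → G.Adj x z → y = z := by
  obtain ⟨x, v, p, hp, hmax⟩ := SimpleGraph.Walk.exists_isPath_forall_isPath_length_le_length G
  have key (y) (hy : G.Adj x y) : y = p.snd := by
    refine h.eq_snd_of_adj_start hp hy ?_
    by_contra hn
    have := hmax _ _ (.cons hy.symm p) (hp.cons hn)
    simp at this
  exact ⟨x, fun y z hy hz ↦ (key y hy).trans (key z hz).symm⟩

/-- A bipartite outerplanar graph with parts `S` and `R` has at most `|R| + 2|S|` edges: there is a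
vertex `x` of `S` which shares two neighbours with at most one other vertex of `S`, and contracting
all edges at `x` loses `|N(x)| + 1` edges at most. -/
theorem Noncrossing.card_le [DecidableEq V] [Finite V] (hm : ∀ a b, a ≠ b → m a b + m b a = 1)
    {S R : Finset V} (hE : E ⊆ S ×ˢ R) (h : Noncrossing m E) : E.card ≤ R.card + 2 * S.card := by
  induction hn : S.card generalizing S R E with
  | zero =>
    rw [Finset.card_eq_zero] at hn
    subst hn
    simp_all
  | succ n ih =>
    obtain ⟨x, hxS, hx⟩ : ∃ x ∈ S, ∀ y z, (twoCommonGraph E).Adj x y →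
        (twoCommonGraph E).Adj x z → y = z := by
      have : Nonempty (S : Set V) := by
        obtain ⟨x, hx⟩ := Finset.card_pos.mp (by omega : 0 < S.card)
        exact ⟨x, hx⟩
      obtain ⟨⟨x, hxS⟩, hx⟩ := ((h.isAcyclic_twoCommonGraph hm).induce
        (S : Set V)).exists_subsingleton_neighborSet
      have mem {y} (hy : (twoCommonGraph E).Adj x y) : y ∈ S := by
        obtain ⟨-, v, w, -, -, -, h1, -⟩ := hy
        exact (Finset.mem_product.mp (hE h1)).1
      refine ⟨x, hxS, fun y z hy hz ↦ ?_⟩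
      simpa using hx ⟨y, mem hy⟩ ⟨z, mem hz⟩ hy hz
    have hSx : (S.erase x).card = n := by rw [Finset.card_erase_of_mem hxS, hn]; rfl
    let N := R.filter fun v ↦ (x, v) ∈ E
    have hN (v) : v ∈ N ↔ (x, v) ∈ E :=
      ⟨fun hv ↦ (Finset.mem_filter.mp hv).2,
        fun hv ↦ Finset.mem_filter.mpr ⟨(Finset.mem_product.mp (hE hv)).2, hv⟩⟩
    let E₁ := E.filter fun e ↦ e.1 ≠ x
    have hE₁ : E.card ≤ N.card + E₁.card := by
      rw [← Finset.card_filter_add_card_filter_not (s := E) (fun e ↦ e.1 = x)]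
      gcongr ?_ + _
      refine Finset.card_le_card_of_injOn Prod.snd ?_ ?_
      · rintro ⟨a, b⟩ hab
        obtain ⟨h1, rfl⟩ := Finset.mem_filter.mp hab
        exact (hN b).mpr h1
      · rintro ⟨a, b⟩ hab ⟨a', b'⟩ hab' heq
        simp_all
    rcases N.eq_empty_or_nonempty with h0 | ⟨v₁, hv₁⟩
    · have := ih (E := E₁) (S := S.erase x) (R := R) (by
        rintro ⟨a, b⟩ hab
        have := Finset.mem_product.mp (hE (Finset.mem_filter.mp hab).1)
        have := (Finset.mem_filter.mp hab).2
        simp_all) (fun s u t w h1 h2 ↦ h s u t w (Finset.mem_filter.mp h1).1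
          (Finset.mem_filter.mp h2).1) hSx
      simp only [h0, Finset.card_empty] at hE₁
      omega
    let φ : V → V := fun v ↦ if v ∈ N then v₁ else v
    let f : V × V → V × V := fun e ↦ (e.1, φ e.2)
    have hφN {v} (hv : v ∈ N) : φ v = v₁ := if_pos hv
    have hφ {v} (hv : v ∉ N) : φ v = v := if_neg hv
    -- The contraction merges at most one pair of edges, because of the choice of `x` and because
    -- no vertex shares three neighbours with `x`; leaving out one of the two makes it injective.
    obtain ⟨e₀, he₀⟩ : ∃ e₀, ∀ a b b', (a, b) ∈ E₁.erase e₀ → (a, b') ∈ E₁.erase e₀ →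
        b ∈ N → b' ∈ N → b = b' := by
      simp only [E₁, Finset.mem_erase, Finset.mem_filter]
      by_cases hy : ∃ y, (twoCommonGraph E).Adj x y
      · obtain ⟨y, hy⟩ := hy
        obtain ⟨hxy, v₀, -, -, hxv, -, hyv, -⟩ := id hy
        refine ⟨(y, v₀), fun a b b' hab hab' hb hb' ↦ ?_⟩
        by_contra hbb
        obtain rfl := hx y a hy ⟨hab.2.2.symm, b, b', hbb, (hN b).mp hb, (hN b').mp hb', hab.2.1,
          hab'.2.1⟩
        exact h.false_of_three_left hm hxy (a := b) (b := b') (c := v₀) hbb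
          (fun e ↦ hab.1 (by rw [e])) (fun e ↦ hab'.1 (by rw [e])) ((hN b).mp hb) ((hN b').mp hb')
          hxv hab.2.1 hab'.2.1 hyv
      · refine ⟨(x, x), fun a b b' hab hab' hb hb' ↦ ?_⟩
        by_contra hbb
        exact hy ⟨a, hab.2.2.symm, b, b', hbb, (hN b).mp hb, (hN b').mp hb', hab.2.1, hab'.2.1⟩
    have hinj : Set.InjOn f (E₁.erase e₀ : Finset (V × V)) := by
      rintro ⟨a, b⟩ hab ⟨a', b'⟩ hab' heq
      obtain ⟨rfl, heq⟩ := Prod.mk.inj heq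
      dsimp only at heq
      congr 1
      by_cases hb : b ∈ N <;> by_cases hb' : b' ∈ N
      · exact he₀ a b b' hab hab' hb hb'
      · rw [hφN hb, hφ hb'] at heq; exact absurd (heq ▸ hv₁) hb'
      · rw [hφN hb', hφ hb] at heq; exact absurd (heq ▸ hv₁) hb
      · rwa [hφ hb', hφ hb] at heq
    have hcard : E₁.card ≤ (E₁.image f).card + 1 := by
      have h1 := Finset.card_image_of_injOn hinj
      have h2 := Finset.card_le_card (Finset.image_subset_image (f := f) (Finset.erase_subset e₀ E₁))
      have h3 := Finset.pred_card_le_card_erase (s := E₁) (a := e₀)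
      omega
    have := ih (E := E₁.image f) (S := S.erase x) (R := insert v₁ (R \ N)) (by
      intro e he
      obtain ⟨⟨a, b⟩, hab, rfl⟩ := Finset.mem_image.mp he
      have h1 := Finset.mem_product.mp (hE (Finset.mem_filter.mp hab).1)
      have h2 := (Finset.mem_filter.mp hab).2
      simp only [Finset.mem_product, Finset.mem_erase, Finset.mem_insert, Finset.mem_sdiff, f]
      refine ⟨⟨h2, h1.1⟩, ?_⟩
      by_cases hb : b ∈ N
      · exact .inl (hφN hb)
      · rw [hφ hb]; exact .inr ⟨h1.2, hb⟩) (by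
      intro s u t w h1 h2 hst huw
      obtain ⟨⟨s', b⟩, hs, hs'⟩ := Finset.mem_image.mp h1
      obtain ⟨⟨t', c⟩, ht, ht'⟩ := Finset.mem_image.mp h2
      obtain ⟨rfl, rfl⟩ := Prod.mk.inj hs'
      obtain ⟨rfl, rfl⟩ := Prod.mk.inj ht'
      obtain ⟨hs, hsx⟩ := Finset.mem_filter.mp hs
      obtain ⟨ht, htx⟩ := Finset.mem_filter.mp ht
      dsimp only at *
      -- A pair of edges of the contracted graph is the sum of pairs of edges of the given one,
      -- along a path with at most two edges in the contracted star.
      by_cases hb : b ∈ N <;> by_cases hc : c ∈ N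
      · rw [hφN hb, hφN hc] at huw; exact absurd rfl huw
      · rw [hφN hb, hφ hc] at *
        have hne {v} (hv : v ∈ N) : v ≠ c := fun e ↦ hc (e ▸ hv)
        have e1 := h _ _ _ _ hs ht hst (hne hb)
        have e2 := h _ _ _ _ ((hN b).mp hb) ht (Ne.symm htx) (hne hb)
        have e3 := h _ _ _ _ ((hN v₁).mp hv₁) ht (Ne.symm htx) (hne hv₁)
        unfold Uncrossed at *
        omega
      · rw [hφN hc, hφ hb] at *
        have hne {v} (hv : v ∈ N) : b ≠ v := fun e ↦ hb (e ▸ hv)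
        have e1 := h _ _ _ _ hs ht hst (hne hc)
        have e2 := h _ _ _ _ hs ((hN c).mp hc) hsx (hne hc)
        have e3 := h _ _ _ _ hs ((hN v₁).mp hv₁) hsx (hne hv₁)
        unfold Uncrossed at *
        omega
      · rw [hφ hb, hφ hc] at *
        exact h _ _ _ _ hs ht hst huw) hSx
    have hNR : N ⊆ R := Finset.filter_subset _ _
    have h1 := Finset.card_insert_le v₁ (R \ N)
    have h2 := Finset.card_sdiff_add_card_eq_card hNR
    omega

end

/-! ### Edges of outerplanar graphs that meet a given set -/

section

variable {V : Type*} {m : V → V → ℤ}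

/-- An outerplanar graph on the disjoint union of `S` and an independent set `R` has at most
`|R| + 3|S|` edges: contracting an edge inside `S` loses at most three edges, since its ends have at
most two common neighbours, and once `S` is independent the bound for bipartite graphs applies. -/
theorem card_le_of_forall_uncrossed [DecidableEq V] [Finite V]
    (hm : ∀ a b, a ≠ b → m a b + m b a = 1) {S R : Finset V} (hSR : Disjoint S R)
    {F : Finset (Sym2 V)}
    (hF : ∀ a b, s(a, b) ∈ F → a ≠ b ∧ (a ∈ S ∨ b ∈ S) ∧ (a ∈ S ∨ a ∈ R))
    (h : ∀ u w a b, s(u, w) ∈ F → s(a, b) ∈ F → u ≠ a → u ≠ b → w ≠ a → w ≠ b →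
      Uncrossed m u w a b) :
    F.card ≤ R.card + 3 * S.card := by
  induction hn : S.card generalizing S F with
  | zero =>
    rw [Finset.card_eq_zero] at hn
    subst hn
    have : F = ∅ := Finset.eq_empty_of_forall_notMem fun e ↦ by
      induction e with | h a b => exact fun he ↦ by simpa using (hF a b he).2.1
    simp [this]
  | succ n ih =>
    have := Fintype.ofFinite V
    by_cases hxy : ∃ x ∈ S, ∃ y ∈ S, s(x, y) ∈ F
    · obtain ⟨x, hx, y, hy, hxyF⟩ := hxy
      have hxy : x ≠ y := (hF _ _ hxyF).1
      have hSy : (S.erase y).card = n := by rw [Finset.card_erase_of_mem hy, hn]; rfl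
      let C := Finset.univ.filter fun b ↦ s(x, b) ∈ F ∧ s(y, b) ∈ F
      have hC : C.card ≤ 2 := by
        by_contra! hc
        obtain ⟨a, ha, b, hb, c, hc, hab, hac, hbc⟩ := Finset.two_lt_card.mp hc
        simp only [C, Finset.mem_filter, Finset.mem_univ, true_and] at ha hb hc
        have U {a b} (ha : s(x, a) ∈ F ∧ s(y, a) ∈ F) (hb : s(x, b) ∈ F ∧ s(y, b) ∈ F)
            (hab : a ≠ b) : Uncrossed m x a y b :=
          h _ _ _ _ ha.1 hb.2 hxy (hF _ _ hb.1).1 (hF _ _ ha.2).1.symm hab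
        exact Uncrossed.false_of_three hm hab hac hbc (U ha hb hab) (U hb ha hab.symm)
          (U ha hc hac) (U hc ha hac.symm) (U hb hc hbc) (U hc hb hbc.symm)
      let ψ : V → V := fun v ↦ if v = y then x else v
      have hψy : ψ y = x := if_pos rfl
      have hψ {v} (hv : v ≠ y) : ψ v = v := if_neg hv
      let F₂ := (F.erase s(x, y)) \ C.image fun b ↦ s(y, b)
      have hcard : F.card ≤ F₂.card + 3 := by
        have h1 := Finset.card_le_card_sdiff_add_card (s := F.erase s(x, y))
          (t := C.image fun b ↦ s(y, b))
        have h2 := Finset.card_image_le (s := C) (f := fun b ↦ s(y, b))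
        have h3 := Finset.card_erase_add_one hxyF
        change _ ≤ F₂.card + _ at h1
        omega
      have hF₂ {e} (he : e ∈ F₂) : e ∈ F :=
        Finset.mem_of_mem_erase (Finset.mem_sdiff.mp he).1
      have hF₂y {b} (he : s(y, b) ∈ F₂) : b ≠ x ∧ s(x, b) ∉ F := by
        refine ⟨?_, fun hb ↦ ?_⟩
        · rintro rfl
          exact (Finset.mem_erase.mp (Finset.mem_sdiff.mp he).1).1 Sym2.eq_swap
        · exact (Finset.mem_sdiff.mp he).2
            (Finset.mem_image.mpr ⟨b, by simp [C, hb, hF₂ he], rfl⟩)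
      -- the edges of the contracted graph are of two kinds
      have cases_mem {e} (he : e ∈ F₂) : (y ∉ e ∧ Sym2.map ψ e = e) ∨
          ∃ b, e = s(y, b) ∧ b ≠ x ∧ b ≠ y ∧ s(x, b) ∉ F ∧ Sym2.map ψ e = s(x, b) := by
        by_cases hye : y ∈ e
        · obtain ⟨b, rfl⟩ := hye
          have hb := (hF _ _ (hF₂ he)).1.symm
          exact .inr ⟨b, rfl, (hF₂y he).1, hb, (hF₂y he).2, by rw [Sym2.map_mk, hψy, hψ hb]⟩
        · refine .inl ⟨hye, ?_⟩
          induction e with | h a b =>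
          simp only [Sym2.mem_iff, not_or] at hye
          rw [Sym2.map_mk, hψ (Ne.symm hye.1), hψ (Ne.symm hye.2)]
      have hinj : Set.InjOn (Sym2.map ψ) (F₂ : Set (Sym2 V)) := by
        intro e he e' he' heq
        rcases cases_mem he with ⟨h1, h2⟩ | ⟨b, rfl, h1, h2, h3, h4⟩ <;>
          rcases cases_mem he' with ⟨h1', h2'⟩ | ⟨b', rfl, h1', h2', h3', h4'⟩
        · rwa [h2, h2'] at heq
        · rw [h2, h4'] at heq
          exact absurd (heq ▸ hF₂ he) h3'
        · rw [h2', h4] at heq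
          exact absurd (heq ▸ hF₂ he') h3
        · rw [h4, h4', Sym2.congr_right] at heq
          rw [heq]
      have key := ih (S := S.erase y) (F := F₂.image (Sym2.map ψ))
        (hSR.mono_left (Finset.erase_subset _ _)) ?_ ?_ hSy
      · rw [Finset.card_image_of_injOn hinj] at key
        omega
      · intro a b hab
        obtain ⟨e, he, hab⟩ := Finset.mem_image.mp hab
        rcases cases_mem he with ⟨h1, h2⟩ | ⟨c, rfl, h1, h2, h3, h4⟩
        · rw [h2] at hab
          subst hab
          have := hF _ _ (hF₂ he)
          simp only [Sym2.mem_iff, not_or] at h1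
          simp only [Finset.mem_erase]
          exact ⟨this.1, this.2.1.imp (⟨Ne.symm h1.1, ·⟩) (⟨Ne.symm h1.2, ·⟩),
            this.2.2.imp_left (⟨Ne.symm h1.1, ·⟩)⟩
        · rw [h4] at hab
          have := hF _ _ (Sym2.eq_swap ▸ hF₂ he : s(c, y) ∈ F)
          have hx' : x ∈ S.erase y := Finset.mem_erase.mpr ⟨hxy, hx⟩
          obtain ⟨rfl, rfl⟩ | ⟨rfl, rfl⟩ := Sym2.eq_iff.mp hab
          · exact ⟨h1.symm, .inl hx', .inl hx'⟩
          · exact ⟨h1, .inr hx', this.2.2.imp_left fun hc ↦ Finset.mem_erase.mpr ⟨h2, hc⟩⟩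
      · -- a contracted edge `xb` is the path `xyb`
        have U {u w a b} (h1 : s(u, w) ∈ F) (h2 : s(y, b) ∈ F) (ha : a = x) (hux : u ≠ x)
            (huy : u ≠ y) (hwx : w ≠ x) (hwy : w ≠ y) (hub : u ≠ b) (hwb : w ≠ b) :
            Uncrossed m u w a b := by
          subst ha
          have e1 := h _ _ _ _ h1 h2 huy hub hwy hwb
          have e2 := h _ _ _ _ h1 hxyF hux huy hwx hwy
          unfold Uncrossed at *
          omega
        intro u w a b huw hab h1 h2 h3 h4
        obtain ⟨e, he, huw⟩ := Finset.mem_image.mp huw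
        obtain ⟨e', he', hab⟩ := Finset.mem_image.mp hab
        rcases cases_mem he with ⟨g1, g2⟩ | ⟨c, rfl, -, g2, g3, g4⟩ <;>
          rcases cases_mem he' with ⟨g1', g2'⟩ | ⟨c', rfl, -, g2', g3', g4'⟩
        · rw [g2] at huw
          rw [g2'] at hab
          subst huw hab
          exact h _ _ _ _ (hF₂ he) (hF₂ he') h1 h2 h3 h4
        · rw [g2] at huw
          rw [g4'] at hab
          subst huw
          simp only [Sym2.mem_iff, not_or] at g1
          obtain ⟨rfl, rfl⟩ | ⟨rfl, rfl⟩ := Sym2.eq_iff.mp hab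
          · exact U (hF₂ he) (hF₂ he') rfl h1 (Ne.symm g1.1) h3 (Ne.symm g1.2) h2 h4
          · exact (U (hF₂ he) (hF₂ he') rfl h2 (Ne.symm g1.1) h4 (Ne.symm g1.2) h1 h3).flip
        · rw [g4] at huw
          rw [g2'] at hab
          subst hab
          simp only [Sym2.mem_iff, not_or] at g1'
          refine Uncrossed.swap hm ?_ h1.symm h3.symm h2.symm h4.symm
          obtain ⟨rfl, rfl⟩ | ⟨rfl, rfl⟩ := Sym2.eq_iff.mp huw
          · exact U (hF₂ he') (hF₂ he) rfl h1.symm (Ne.symm g1'.1) h2.symm (Ne.symm g1'.2)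
              h3.symm h4.symm
          · exact (U (hF₂ he') (hF₂ he) rfl h3.symm (Ne.symm g1'.1) h4.symm (Ne.symm g1'.2)
              h1.symm h2.symm).flip
        · rw [g4] at huw
          rw [g4'] at hab
          have h5 : x = u ∨ x = w := Sym2.mem_iff.mp (huw ▸ Sym2.mem_mk_left x c)
          have h6 : x = a ∨ x = b := Sym2.mem_iff.mp (hab ▸ Sym2.mem_mk_left x c')
          rcases h5 with rfl | rfl <;> rcases h6 with rfl | rfl <;> contradiction
    · push Not at hxy
      let E := (S ×ˢ R).filter fun e ↦ s(e.1, e.2) ∈ F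
      have hE : E ⊆ S ×ˢ R := Finset.filter_subset _ _
      have hFE : F ⊆ E.image fun e ↦ s(e.1, e.2) := by
        intro e he
        induction e with | h a b =>
        have h1 := hF _ _ he
        have h2 := hF _ _ (Sym2.eq_swap ▸ he : s(b, a) ∈ F)
        rw [Finset.mem_image]
        by_cases ha : a ∈ S
        · have hb : b ∉ S := fun hb ↦ hxy a ha b hb he
          exact ⟨(a, b), by simp_all [E], rfl⟩
        · exact ⟨(b, a), by simp_all [E, Sym2.eq_swap], Sym2.eq_swap⟩
      have hN : Noncrossing m E := by
        intro s u t w h1 h2 hst huw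
        simp only [E, Finset.mem_filter, Finset.mem_product] at h1 h2
        have hd := Finset.disjoint_left.mp hSR
        exact h _ _ _ _ h1.2 h2.2 hst (fun e ↦ hd h1.1.1 (e ▸ h2.1.2))
          (fun e ↦ hd h2.1.1 (e ▸ h1.1.2)) huw
      have := hN.card_le hm hE
      have := (Finset.card_le_card hFE).trans Finset.card_image_le
      omega

end

/-! ### Deleting vertices of large degree -/

section

variable {V : Type*} [DecidableEq V]

theorem card_filter_meet_add_card_le (F : Finset (Sym2 V)) {P T R : Finset V} (hT : Disjoint T P)
    (hR : Disjoint R P) (hTR : Disjoint T R) {E : Finset (V × V)} (hE : E ⊆ T ×ˢ R)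
    (hEF : ∀ e ∈ E, s(e.1, e.2) ∈ F) :
    (F.filter fun e ↦ ∃ v ∈ P, v ∈ e).card + E.card ≤
      (F.filter fun e ↦ ∃ v ∈ P ∪ T, v ∈ e).card := by
  have hinj : Set.InjOn (fun e : V × V ↦ s(e.1, e.2)) (E : Set (V × V)) := by
    rintro ⟨a, b⟩ hab ⟨c, d⟩ hcd heq
    have h1 := Finset.mem_product.mp (hE hab)
    have h2 := Finset.mem_product.mp (hE hcd)
    obtain ⟨rfl, rfl⟩ | ⟨rfl, rfl⟩ := Sym2.eq_iff.mp heq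
    · rfl
    · exact absurd h2.2 (Finset.disjoint_left.mp hTR h1.1)
  rw [← Finset.card_image_of_injOn hinj, ← Finset.card_union_of_disjoint]
  · refine Finset.card_le_card fun e he ↦ ?_
    rcases Finset.mem_union.mp he with he | he
    · obtain ⟨h1, v, hv, hve⟩ := Finset.mem_filter.mp he
      exact Finset.mem_filter.mpr ⟨h1, v, Finset.mem_union_left _ hv, hve⟩
    · obtain ⟨⟨a, b⟩, hab, rfl⟩ := Finset.mem_image.mp he
      exact Finset.mem_filter.mpr ⟨hEF _ hab, a, Finset.mem_union_right _
        (Finset.mem_product.mp (hE hab)).1, Sym2.mem_mk_left _ _⟩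
  · refine Finset.disjoint_left.mpr fun e he he' ↦ ?_
    obtain ⟨-, v, hv, hve⟩ := Finset.mem_filter.mp he
    obtain ⟨⟨a, b⟩, hab, rfl⟩ := Finset.mem_image.mp he'
    have h1 := Finset.mem_product.mp (hE hab)
    rcases Sym2.mem_iff.mp hve with rfl | rfl
    · exact Finset.disjoint_left.mp hT h1.1 hv
    · exact Finset.disjoint_left.mp hR h1.2 hv

/-- The set to be deleted is `P ∪ T`. Here `P` is a largest set that is met by at least
`(k + 2) |P|` edges, so that no vertex of degree at least `k + 2` remains outside `P`, and `T` is a maximal independent set of vertices of degree `k + 1`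
in the remaining graph, so that it dominates these vertices. The two inequalities are the bounds for
the number of edges that meet `P ∪ T`, and for the number of edges that join `T` to the vertices
that are kept. -/
theorem exists_deletion [Fintype V] (G : SimpleGraph V) [DecidableRel G.Adj] {m : V → V → ℤ}
    (hm : ∀ a b, a ≠ b → m a b + m b a = 1)
    (h : ∀ u w a b, G.Adj u w → G.Adj a b → u ≠ a → u ≠ b → w ≠ a → w ≠ b → Uncrossed m u w a b)
    (k : ℕ) :
    ∃ (D : Finset V) (t u : ℕ), t + u = D.card ∧ k * t + k * u ≤ Fintype.card V + u ∧
      k * u + t ≤ Fintype.card V ∧ ∀ v ∉ D, (G.neighborFinset v \ D).card ≤ k := by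
  let meet (P : Finset V) := G.edgeFinset.filter fun e ↦ ∃ v ∈ P, v ∈ e
  obtain ⟨P, hP, hPmax⟩ := Finset.exists_max_image
    (Finset.univ.filter fun P : Finset V ↦ (k + 2) * P.card ≤ (meet P).card) Finset.card
    ⟨∅, by simp⟩
  replace hP := (Finset.mem_filter.mp hP).2
  -- by maximality, the degrees outside `P` are at most `k + 1`
  have hdeg (v) (hv : v ∉ P) : (G.neighborFinset v \ P).card ≤ k + 1 := by
    by_contra! hc
    have h1 := card_filter_meet_add_card_le G.edgeFinset (P := P) (T := {v})
      (R := G.neighborFinset v \ P) (E := {v} ×ˢ (G.neighborFinset v \ P)) (by simpa)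
      Finset.sdiff_disjoint (by simp) (Finset.Subset.refl _) (by
        rintro ⟨a, b⟩ hab
        simp only [Finset.mem_product, Finset.mem_singleton, Finset.mem_sdiff,
          SimpleGraph.mem_neighborFinset] at hab
        obtain ⟨rfl, hab, -⟩ := hab
        simpa using hab)
    rw [Finset.card_product, Finset.card_singleton, one_mul] at h1
    have h2 : (P ∪ {v}).card = P.card + 1 := by
      rw [Finset.card_union_of_disjoint (by simpa), Finset.card_singleton]
    have h3 := hPmax (P ∪ {v}) (Finset.mem_filter.mpr ⟨Finset.mem_univ _, by
      rw [h2, mul_add]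
      change _ ≤ (Finset.filter _ _).card
      change _ ≤ (Finset.filter _ _).card at hP
      omega⟩)
    omega
  obtain ⟨T, hT, hTmax⟩ := Finset.exists_max_image
    (Finset.univ.filter fun T : Finset V ↦ (∀ v ∈ T, v ∉ P ∧ (G.neighborFinset v \ P).card = k + 1) ∧
      ∀ v ∈ T, ∀ w ∈ T, ¬ G.Adj v w) Finset.card
    ⟨∅, by simp⟩
  obtain ⟨hT, hTind⟩ := (Finset.mem_filter.mp hT).2
  have hTP : Disjoint T P := Finset.disjoint_left.mpr fun v hv ↦ (hT v hv).1
  let R := (P ∪ T)ᶜ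
  have hR : R.card + (P.card + T.card) = Fintype.card V := by
    rw [← Finset.card_union_of_disjoint hTP.symm]
    exact Finset.card_compl_add_card _
  have hRP : Disjoint R P := (Finset.disjoint_right.mpr fun v hv ↦ by simp [R, hv])
  have hTR : Disjoint T R := (Finset.disjoint_left.mpr fun v hv ↦ by simp [R, hv])
  let E := (T ×ˢ R).filter fun e ↦ G.Adj e.1 e.2
  have hEcard : E.card = (k + 1) * T.card := by
    have h1 : E = (T.sigma fun v ↦ G.neighborFinset v \ P).image
        fun e : (_ : V) × V ↦ (e.1, e.2) := by
      ext ⟨a, b⟩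
      simp only [E, R, Finset.mem_filter, Finset.mem_product, Finset.mem_compl, Finset.mem_union,
        Finset.mem_image, Finset.mem_sigma, Finset.mem_sdiff, SimpleGraph.mem_neighborFinset,
        Sigma.exists, Prod.mk.injEq]
      constructor
      · rintro ⟨⟨ha, hb⟩, hab⟩
        exact ⟨a, b, ⟨ha, hab, fun hb' ↦ hb (.inl hb')⟩, rfl, rfl⟩
      · rintro ⟨a, b, ⟨ha, hab, hb⟩, rfl, rfl⟩
        exact ⟨⟨ha, not_or.mpr ⟨hb, fun hb' ↦ hTind _ ha _ hb' hab⟩⟩, hab⟩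
    rw [h1, Finset.card_image_of_injective, Finset.card_sigma, Finset.sum_congr rfl
      fun v hv ↦ (hT v hv).2, Finset.sum_const, smul_eq_mul, mul_comm]
    rintro ⟨a, b⟩ ⟨c, d⟩ heq
    simpa using heq
  have hET : E ⊆ T ×ˢ R := Finset.filter_subset _ _
  refine ⟨P ∪ T, P.card, T.card, (Finset.card_union_of_disjoint hTP.symm).symm, ?_, ?_, ?_⟩
  · have h1 := card_filter_meet_add_card_le G.edgeFinset hTP hRP hTR hET (by
      rintro ⟨a, b⟩ hab
      simpa using (Finset.mem_filter.mp hab).2)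
    have h2 := card_le_of_forall_uncrossed hm (S := P ∪ T) (R := R) (F := meet (P ∪ T))
      disjoint_compl_right (fun a b hab ↦ by
        obtain ⟨h1, v, hv, hve⟩ := Finset.mem_filter.mp hab
        refine ⟨by rintro rfl; simp at h1, ?_, ?_⟩
        · rcases Sym2.mem_iff.mp hve with rfl | rfl
          · exact .inl hv
          · exact .inr hv
        · by_cases ha : a ∈ P ∪ T
          · exact .inl ha
          · exact .inr (Finset.mem_compl.mpr ha)) (fun u w a b huw hab ↦ h u w a b
        (by simpa using (Finset.mem_filter.mp huw).1) (by simpa using (Finset.mem_filter.mp hab).1))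
    rw [Finset.card_union_of_disjoint hTP.symm] at h2
    simp only [meet, hEcard] at h1 h2 hP
    rw [add_mul] at hP h1
    omega
  · have hN : Noncrossing m E := by
      intro s u t w h1 h2 hst huw
      simp only [E, Finset.mem_filter, Finset.mem_product] at h1 h2
      have hd := Finset.disjoint_left.mp hTR
      exact h _ _ _ _ h1.2 h2.2 hst (fun e ↦ hd h1.1.1 (e ▸ h2.1.2))
        (fun e ↦ hd h2.1.1 (e ▸ h1.1.2)) huw
    have h1 := hN.card_le hm hET
    rw [hEcard, add_mul] at h1
    omega
  · intro v hv
    obtain ⟨hvP, hvT⟩ := not_or.mp (Finset.mem_union.not.mp hv)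
    have hsub : G.neighborFinset v \ (P ∪ T) ⊆ G.neighborFinset v \ P :=
      Finset.sdiff_subset_sdiff (Finset.Subset.refl _) Finset.subset_union_left
    by_cases hk : (G.neighborFinset v \ P).card = k + 1
    · -- by maximality, `v` has a neighbour in `T`
      obtain ⟨w, hw, hvw⟩ : ∃ w ∈ T, G.Adj v w := by
        by_contra! hc
        have := hTmax (insert v T) (Finset.mem_filter.mpr ⟨Finset.mem_univ _, ?_, ?_⟩)
        · rw [Finset.card_insert_of_notMem hvT] at this
          omega
        · intro x hx
          rcases Finset.mem_insert.mp hx with rfl | hx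
          · exact ⟨hvP, hk⟩
          · exact hT x hx
        · intro x hx y hy hxy
          rcases Finset.mem_insert.mp hx with rfl | hx <;>
            rcases Finset.mem_insert.mp hy with rfl | hy
          · exact hxy.ne rfl
          · exact hc y (by assumption) hxy
          · exact hc x (by assumption) hxy.symm
          · exact hTind x (by assumption) y (by assumption) hxy
      have : G.neighborFinset v \ (P ∪ T) ⊂ G.neighborFinset v \ P :=
        (Finset.ssubset_iff_of_subset hsub).mpr ⟨w, by simp [hvw, (hT w hw).1], by simp [hw]⟩
      have := Finset.card_lt_card this
      omega
    · have := Finset.card_le_card hsub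
      have := hdeg v hvP
      omega

end

/-! ### Variation of the logarithm along a path -/

/-- A continuous function without zeros on a simply connected space has a continuous logarithm. -/
theorem exists_continuous_log {X : Type*} [TopologicalSpace X] [LocallyPathConnectedSpace X]
    [SimplyConnectedSpace X] {p : X → ℂ} (hp : Continuous p) (h0 : ∀ s, p s ≠ 0) :
    ∃ L : X → ℂ, Continuous L ∧ ∀ s, Complex.exp (L s) = p s := by
  obtain ⟨x⟩ : Nonempty X := inferInstance
  obtain ⟨L, ⟨-, hL⟩, -⟩ := Complex.isCoveringMapOn_exp.existsUnique_continuousMap_lifts ⟨p, hp⟩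
    (Complex.exp_log (h0 x)) h0
  exact ⟨L, L.continuous, fun s ↦ congrFun hL s⟩

open Classical in
/-- The variation `L 1 - L 0` of a continuous logarithm `L` of `p : ℝ → ℂ` from `0` to `1`;
the junk value `0` if there is no such logarithm. -/
noncomputable def logVar (p : ℝ → ℂ) : ℂ :=
  if h : ∃ L : ℝ → ℂ, Continuous L ∧ ∀ s, Complex.exp (L s) = p s then h.choose 1 - h.choose 0
  else 0

theorem logVar_eq {p L : ℝ → ℂ} (hL : Continuous L) (h : ∀ s, Complex.exp (L s) = p s) :
    logVar p = L 1 - L 0 := by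
  have hex : ∃ L : ℝ → ℂ, Continuous L ∧ ∀ s, Complex.exp (L s) = p s := ⟨L, hL, h⟩
  obtain ⟨hL', h'⟩ := hex.choose_spec
  rw [logVar, dif_pos hex]
  generalize hex.choose = L' at hL' h'
  have hp : Continuous p := by
    rw [← funext h]
    exact Complex.continuous_exp.comp hL
  have hc : Complex.exp (L 0 - L' 0) = 1 := by
    rw [Complex.exp_sub, h, h', div_self]
    rw [← h]
    exact Complex.exp_ne_zero _
  have huniq := Complex.isCoveringMapOn_exp.existsUnique_continuousMap_lifts ⟨p, hp⟩ (a₀ := 0)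
    (e₀ := L 0) (h 0) (fun s ↦ by simp [← h])
  have heq := huniq.unique (y₁ := ⟨L, hL⟩) (y₂ := ⟨fun s ↦ L' s + (L 0 - L' 0), by fun_prop⟩)
    ⟨rfl, funext h⟩ ⟨by simp, funext fun s ↦ by simp [Complex.exp_add, hc, h']⟩
  have h1 : L 1 = L' 1 + (L 0 - L' 0) := congrArg (fun f : C(ℝ, ℂ) ↦ f 1) heq
  rw [h1]
  ring

theorem exp_logVar {p : ℝ → ℂ} (hp : Continuous p) (h0 : ∀ s, p s ≠ 0) :
    Complex.exp (logVar p) = p 1 / p 0 := by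
  obtain ⟨L, hL, h⟩ := exists_continuous_log hp h0
  rw [logVar_eq hL h, Complex.exp_sub, h, h]

theorem logVar_sub_comm {p q : ℝ → ℂ} (hp : Continuous p) (hq : Continuous q)
    (h0 : ∀ s, p s ≠ q s) : logVar (fun s ↦ p s - q s) = logVar (fun s ↦ q s - p s) := by
  obtain ⟨L, hL, h⟩ := exists_continuous_log (p := fun s ↦ p s - q s) (by fun_prop)
    fun s ↦ sub_ne_zero.mpr (h0 s)
  rw [logVar_eq hL h, logVar_eq (L := fun s ↦ L s + Real.pi * Complex.I) (by fun_prop)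
    fun s ↦ by rw [Complex.exp_add, h, Complex.exp_pi_mul_I]; ring]
  ring

/-- For two disjoint paths `p` and `q`, the difference `p s - q t` has no zero on the unit square,
so its logarithm varies by the same amount along the two ways from the corner `(0, 0)` to the corner
`(1, 1)`. -/
theorem logVar_square {p q : ℝ → ℂ} (hp : Continuous p) (hq : Continuous q)
    (h0 : ∀ s t, p s ≠ q t) :
    logVar (fun s ↦ p s - q 0) + logVar (fun t ↦ p 1 - q t) =
      logVar (fun t ↦ p 0 - q t) + logVar (fun s ↦ p s - q 1) := by
  obtain ⟨L, hL, h⟩ := exists_continuous_log (p := fun x : ℝ × ℝ ↦ p x.1 - q x.2) (by fun_prop)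
    fun x ↦ sub_ne_zero.mpr (h0 x.1 x.2)
  rw [logVar_eq (L := fun s ↦ L (s, 0)) (by fun_prop) fun s ↦ h (s, 0),
    logVar_eq (L := fun t ↦ L (1, t)) (by fun_prop) fun t ↦ h (1, t),
    logVar_eq (L := fun t ↦ L (0, t)) (by fun_prop) fun t ↦ h (0, t),
    logVar_eq (L := fun s ↦ L (s, 1)) (by fun_prop) fun s ↦ h (s, 1)]
  ring

/-- Let `γ a` be paths from `z` to distinct points `x a`, none of which passes through another of
these points. Move a pair of points from `(z, x b)` along `γ a` to `(x a, x b)`, and from there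
along the reverse of `γ b` to `(x a, z)`. The logarithm of their difference varies by
`log (x a - z) - log (x b - z) - π i`, up to an integral multiple `m a b` of `2 π i`. Exchanging the
two points reverses the motion, whence `m a b + m b a = 1`. -/
theorem exists_winding {V : Type*} {x : V → ℂ} {z : ℂ} {γ : V → ℝ → ℂ}
    (hx : Function.Injective x) (hz : ∀ a, x a ≠ z) (hγ : ∀ a, Continuous (γ a))
    (h0 : ∀ a, γ a 0 = z) (h1 : ∀ a, γ a 1 = x a) (hne : ∀ a b s, a ≠ b → γ a s ≠ x b) :
    ∃ m : V → V → ℤ, (∀ a b, a ≠ b → m a b + m b a = 1) ∧ ∀ a b, a ≠ b →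
      logVar (fun s ↦ γ a s - x b) - logVar (fun s ↦ γ b s - x a) =
        Complex.log (x a - z) - Complex.log (x b - z) - Real.pi * Complex.I +
          m a b * (2 * Real.pi * Complex.I) := by
  have key (a b : V) (hab : a ≠ b) : ∃ n : ℤ,
      logVar (fun s ↦ γ a s - x b) - logVar (fun s ↦ γ b s - x a) =
        Complex.log (x a - z) - Complex.log (x b - z) - Real.pi * Complex.I +
          n * (2 * Real.pi * Complex.I) := by
    apply Complex.exp_eq_exp_iff_exists_int.mp
    have hγ₁ := hγ a
    have hγ₂ := hγ b
    have e1 : x a - z ≠ 0 := sub_ne_zero.mpr (hz a)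
    have e2 : x b - z ≠ 0 := sub_ne_zero.mpr (hz b)
    have e3 : z - x a ≠ 0 := sub_ne_zero.mpr (hz a).symm
    have e4 : z - x b ≠ 0 := sub_ne_zero.mpr (hz b).symm
    have e5 : x a - x b ≠ 0 := sub_ne_zero.mpr (hx.ne hab)
    have e6 : x b - x a ≠ 0 := sub_ne_zero.mpr (hx.ne hab.symm)
    rw [Complex.exp_sub, exp_logVar (by fun_prop) (fun s ↦ sub_ne_zero.mpr (hne a b s hab)),
      exp_logVar (by fun_prop) (fun s ↦ sub_ne_zero.mpr (hne b a s hab.symm)), Complex.exp_sub,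
      Complex.exp_sub, Complex.exp_log e1, Complex.exp_log e2, Complex.exp_pi_mul_I, h0, h0, h1, h1]
    field_simp
    ring
  choose! m hm using key
  refine ⟨m, fun a b hab ↦ ?_, hm⟩
  have h2 : (m a b + m b a - 1 : ℂ) * (2 * Real.pi * Complex.I) = 0 := by
    linear_combination -hm a b hab - hm b a hab.symm
  have h3 := (mul_eq_zero.mp h2).resolve_right Complex.two_pi_I_ne_zero
  have h4 : ((m a b + m b a - 1 : ℤ) : ℂ) = 0 := by exact_mod_cast h3
  have := Int.cast_eq_zero.mp h4
  omega

/-! ### Outerplanar drawings -/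

namespace SimpleGraph.Drawing

variable {V : Type*} {G : SimpleGraph V}

theorem isCompact_arc (D : G.Drawing) (e : G.edgeSet) : IsCompact (D.arc e) := by
  obtain ⟨e, he⟩ := e
  induction e with | h u v =>
  obtain ⟨γ, -, hγ⟩ := D.isJordanArc_arc u v he
  rw [← hγ]
  exact isCompact_range γ.continuous

/-- All vertices can be reached from a point of the outer face by paths that avoid all other
vertices and all edges not incident to the vertex. Such a path may run along edges that are
incident to the vertex: it arrives in a small ball around it by a straight segment. -/
theorem IsOuterplanar.exists_path [Finite V] {D : G.Drawing} (hD : D.IsOuterplanar) :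
    ∃ (z : Plane) (γ : ∀ a, _root_.Path z (D.point a)), (∀ a, D.point a ≠ z) ∧
      (∀ a b s, a ≠ b → γ a s ≠ D.point b) ∧ ∀ a (e : G.edgeSet) s, a ∉ e.1 → γ a s ∉ D.arc e := by
  obtain ⟨⟨hpt, -⟩, F, ⟨⟨z, hz, rfl⟩, -⟩, hfr⟩ := hD
  have hclosed : IsClosed D.support :=
    (Set.finite_range D.point).isClosed.union
      (isClosed_iUnion_of_finite fun e ↦ (D.isCompact_arc e).isClosed)
  have hF : IsPathConnected (connectedComponentIn D.supportᶜ z) :=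
    (hclosed.isOpen_compl.connectedComponentIn).isConnected_iff_isPathConnected.mp
      (isConnected_connectedComponentIn_iff.mpr hz)
  have key (a : V) : ∃ γ : _root_.Path z (D.point a), (∀ b s, a ≠ b → γ s ≠ D.point b) ∧
      ∀ (e : G.edgeSet) s, a ∉ e.1 → γ s ∉ D.arc e := by
    let K : Set Plane := D.point '' {b | a ≠ b} ∪ ⋃ e : {e : G.edgeSet // a ∉ e.1}, D.arc e.1
    have hK : IsClosed K := (Set.toFinite _).isClosed.union
      (isClosed_iUnion_of_finite fun e ↦ (D.isCompact_arc e).isClosed)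
    have haK : D.point a ∈ Kᶜ := by
      rintro (⟨b, hb, hba⟩ | h)
      · exact hb (D.point_injective hba).symm
      · obtain ⟨⟨e, he⟩, h⟩ := Set.mem_iUnion.mp h
        exact he (hpt a e h)
    have hKsupp : D.supportᶜ ⊆ Kᶜ := by
      refine Set.compl_subset_compl.mpr (Set.union_subset_union (Set.image_subset_range _ _) ?_)
      exact Set.iUnion_subset fun e ↦ Set.subset_iUnion D.arc e.1
    obtain ⟨ε, hε, hball⟩ := Metric.isOpen_iff.mp hK.isOpen_compl _ haK
    obtain ⟨p, hpF, hp⟩ := Metric.mem_closure_iff.mp (frontier_subset_closure (hfr a)) ε hε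
    have h1 : JoinedIn Kᶜ z p :=
      (hF.joinedIn z (mem_connectedComponentIn hz) p hpF).mono
        ((connectedComponentIn_subset _ _).trans hKsupp)
    have h2 : JoinedIn Kᶜ p (D.point a) :=
      (JoinedIn.of_segment_subset ((convex_ball (D.point a) ε).segment_subset
        (Metric.mem_ball'.mpr hp) (Metric.mem_ball_self hε))).mono hball
    obtain ⟨γ, hγ⟩ := h1.trans h2
    exact ⟨γ, fun b s hab heq ↦ hγ s (.inl ⟨b, hab, heq.symm⟩), fun e s he hes ↦
      hγ s (.inr (Set.mem_iUnion.mpr ⟨⟨e, he⟩, hes⟩))⟩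
  choose γ h1 h2 using key
  exact ⟨z, γ, fun a ha ↦ hz (.inl ⟨a, ha⟩), h1, h2⟩

end SimpleGraph.Drawing

/-- An outerplanar graph admits integers `m a b` with `m a b + m b a = 1` for which any two disjoint
edges are uncrossed. The numbers are those of `exists_winding` for paths from a point `z` of the
outer face; that the edges `e`, from `u` to `w`, and `f`, from `a` to `b`, are uncrossed follows
from `logVar_square`, applied to `e` and `f`, to `f` and the paths to `u` and `w`, and to `e` and
the paths to `a` and `b`. -/
theorem SimpleGraph.IsOuterplanar.exists_uncrossed {V : Type*} [Finite V] {G : SimpleGraph V}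
    (hG : G.IsOuterplanar) :
    ∃ m : V → V → ℤ, (∀ a b, a ≠ b → m a b + m b a = 1) ∧ ∀ u w a b, G.Adj u w → G.Adj a b →
      u ≠ a → u ≠ b → w ≠ a → w ≠ b → Uncrossed m u w a b := by
  obtain ⟨D, hD⟩ := hG
  obtain ⟨z, γ, hz, hne, harc⟩ := hD.exists_path
  obtain ⟨⟨hpt, hdisj⟩, -⟩ := hD
  let φ : Plane ≃ₗᵢ[ℝ] ℂ := Complex.orthonormalBasisOneI.repr.symm
  have hφ : Continuous φ := φ.continuous
  let x : V → ℂ := fun a ↦ φ (D.point a)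
  let g : V → ℝ → ℂ := fun a s ↦ φ ((γ a).extend s)
  have hx : Function.Injective x := φ.injective.comp D.point_injective
  have hg (a) : Continuous (g a) := hφ.comp (γ a).continuous_extend
  have hg0 (a) : g a 0 = φ z := by simp [g]
  have hg1 (a) : g a 1 = x a := by simp [g, x]
  -- the values of an extended path are values of the path
  have hext {p q : Plane} (δ : _root_.Path p q) (s : ℝ) : δ.extend s ∈ Set.range δ :=
    δ.extend_range ▸ Set.mem_range_self s
  have hgx (a b s) (hab : a ≠ b) : g a s ≠ x b := by
    obtain ⟨t, ht⟩ := hext (γ a) s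
    exact fun h ↦ hne a b t hab (ht.trans (φ.injective h))
  obtain ⟨m, hm, hmlog⟩ := exists_winding hx (fun a ↦ φ.injective.ne (hz a)) hg hg0 hg1 hgx
  refine ⟨m, hm, fun u w a b huw hab h1 h2 h3 h4 ↦ ?_⟩
  obtain ⟨e, -, he⟩ := D.isJordanArc_arc u w huw
  obtain ⟨f, -, hf⟩ := D.isJordanArc_arc a b hab
  have hef (s t) : φ (e.extend s) ≠ φ (f.extend t) := by
    intro h
    have hne : s(u, w) ≠ s(a, b) := by simp [h1, h2]
    obtain ⟨v, ⟨hv, hv'⟩, -⟩ := hdisj ⟨s(u, w), huw⟩ ⟨s(a, b), hab⟩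
      (fun h ↦ hne (Subtype.ext_iff.mp h)) ⟨he ▸ hext e s, hf ▸ φ.injective h ▸ hext f t⟩
    rcases Sym2.mem_iff.mp hv with rfl | rfl <;> rcases Sym2.mem_iff.mp hv' with rfl | rfl <;>
      contradiction
  have hgf {v p q} (h : G.Adj p q) {δ : _root_.Path (D.point p) (D.point q)}
      (hδ : Set.range δ = D.arc ⟨s(p, q), h⟩) (hp : v ≠ p) (hq : v ≠ q) (s t : ℝ) :
      g v s ≠ φ (δ.extend t) := by
    intro heq
    obtain ⟨r, hr⟩ := hext (γ v) s
    refine harc v ⟨s(p, q), h⟩ r (by simp [hp, hq]) ?_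
    rw [hr, φ.injective heq, ← hδ]
    exact hext δ t
  have hec : Continuous fun s ↦ φ (e.extend s) := hφ.comp e.continuous_extend
  have hfc : Continuous fun s ↦ φ (f.extend s) := hφ.comp f.continuous_extend
  have hxe {v} (hu : v ≠ u) (hw : v ≠ w) (s) : x v ≠ φ (e.extend s) :=
    hg1 v ▸ hgf huw he hu hw 1 s
  have s1 := logVar_square hec hfc hef
  have s2 := logVar_square (hg u) hfc (hgf hab hf h1 h2)
  have s3 := logVar_square (hg w) hfc (hgf hab hf h3 h4)
  have s4 := logVar_square (hg a) hec (hgf huw he h1.symm h3.symm)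
  have s5 := logVar_square (hg b) hec (hgf huw he h2.symm h4.symm)
  have c1 := logVar_sub_comm (p := fun _ ↦ x a) continuous_const hec (hxe h1.symm h3.symm)
  have c2 := logVar_sub_comm (p := fun _ ↦ x b) continuous_const hec (hxe h2.symm h4.symm)
  simp only [_root_.Path.extend_zero, _root_.Path.extend_one, hg0, hg1] at s1 s2 s3 s4 s5
  have key : ((m u a + m w b - (m w a + m u b) : ℤ) : ℂ) * (2 * Real.pi * Complex.I) = 0 := by
    push_cast
    linear_combination -hmlog u a h1 - hmlog w b h4 + hmlog w a h3 + hmlog u b h2 + s1 + s2 - s3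
      - s4 + s5 + c1 - c2
  have := Int.cast_eq_zero.mp ((mul_eq_zero.mp key).resolve_right Complex.two_pi_I_ne_zero)
  unfold Uncrossed
  omega

/-! ### Induced subgraphs of bounded degree -/

theorem SimpleGraph.maxDegree_induce_compl_le {V : Type*} [Fintype V] [DecidableEq V]
    (G : SimpleGraph V) [DecidableRel G.Adj] {D : Finset V} {k : ℕ}
    (h : ∀ v ∉ D, (G.neighborFinset v \ D).card ≤ k) :
    (G.induce {v | v ∈ Dᶜ}).maxDegree ≤ k := by
  refine SimpleGraph.maxDegree_le_of_forall_degree_le _ _ fun v ↦ ?_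
  refine le_trans ?_ (h v (Finset.mem_compl.mp v.2))
  rw [← SimpleGraph.card_neighborFinset_eq_degree]
  refine Finset.card_le_card_of_injOn Subtype.val (fun w hw ↦ ?_) Subtype.val_injective.injOn
  have hw' : G.Adj v w := by simpa using hw
  simpa [hw'] using Finset.mem_compl.mp w.2

theorem mainTheorem4 {V : Type*} [Fintype V] [DecidableEq V] (G : SimpleGraph V)
    [DecidableRel G.Adj] (hG : G.IsOuterplanar) (k : ℕ) (hk : 4 ≤ k) :
    ∃ I : Finset V,
      (G.induce {v | v ∈ I}).maxDegree ≤ k ∧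
      (Even k → (2 * (k : ℝ) + 1) / (2 * (k : ℝ) + 5) * (Fintype.card V : ℝ) ≤ (I.card : ℝ)) ∧
      (Odd k → (2 * (k : ℝ) + 2 / 3) / (2 * (k : ℝ) + 14 / 3) * (Fintype.card V : ℝ)
        ≤ (I.card : ℝ)) := by
  obtain ⟨m, hm, huncrossed⟩ := hG.exists_uncrossed
  obtain ⟨D, t, u, hD, h1, h2, hdeg⟩ := exists_deletion G hm huncrossed k
  have hcard : Dᶜ.card + D.card = Fintype.card V := Finset.card_compl_add_card D
  have hk' : (4 : ℝ) ≤ k := by exact_mod_cast hk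
  have hI : (Dᶜ.card : ℝ) = Fintype.card V - (t + u) := by
    rw [eq_sub_iff_add_eq]
    exact_mod_cast hD ▸ hcard
  have h1' : (k : ℝ) * t + k * u ≤ Fintype.card V + u := by exact_mod_cast h1
  have h2' : (k : ℝ) * u + t ≤ Fintype.card V := by exact_mod_cast h2
  have hn : (0 : ℝ) ≤ Fintype.card V := Nat.cast_nonneg _
  set n : ℝ := (Fintype.card V : ℝ)
  have hpos : (0 : ℝ) < k ^ 2 - k + 1 := by nlinarith
  -- `k - 1` times the first inequality plus the second one
  have key : ((k : ℝ) ^ 2 - k + 1) * (t + u) ≤ k * n := by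
    linarith [mul_le_mul_of_nonneg_left h1' (by linarith : (0 : ℝ) ≤ k - 1)]
  have bound {c : ℝ} (hc : (k : ℝ) ≤ c * (k ^ 2 - k + 1)) : t + u ≤ c * n := by
    refine le_of_mul_le_mul_left (key.trans ?_) hpos
    linarith [mul_le_mul_of_nonneg_right hc hn]
  refine ⟨Dᶜ, G.maxDegree_induce_compl_le hdeg, fun _ ↦ ?_, fun _ ↦ ?_⟩
  · have hc : (t + u : ℝ) ≤ 4 / (2 * k + 5) * n := bound (by
      rw [div_mul_eq_mul_div, le_div_iff₀ (by positivity)]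
      nlinarith)
    have : (2 * (k : ℝ) + 1) / (2 * k + 5) = 1 - 4 / (2 * k + 5) := by
      field_simp
      ring
    rw [hI, this]
    linarith
  · have hc : (t + u : ℝ) ≤ 4 / (2 * k + 14 / 3) * n := bound (by
      rw [div_mul_eq_mul_div, le_div_iff₀ (by positivity)]
      nlinarith)
    have : (2 * (k : ℝ) + 2 / 3) / (2 * k + 14 / 3) = 1 - 4 / (2 * k + 14 / 3) := by
      field_simp
      ring
    rw [hI, this]
    linarith
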